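/- Let $p$ be an odd prime, $m\ge 1$, $n=2m$, and let $\theta$ be a primitive element of $\mathbb F_{p^n}$. Let $t$ be a positive integer with $t\equiv 2\pmod 4$ and $t\not\equiv 0\pmod{p^m+1}$. Set $s_1=\frac{t+2}{4}$, $s_2=\frac{3t+2}{4}$, $d_1=s_1(p^m-1)+1$, $d_2=s_2(p^m-1)+1$ and $l=\gcd(t,p^m+1)$. Let $\mathcal C_{p^n,d_1,d_2}$ be the cyclic code of length $p^n-1$ over $\mathbb F_p$ whose generator polynomial is $g_{d_1}(x)g_{d_2}(x)$, where $g_i(x)$ is the minimal polynomial of $\theta^i$ over $\mathbb F_p$, and let $\mathcal C_{p^n,d_1,d_2}^{\perp}$ be its dual code. Then $\mathcal C_{p^n,d_1,d_2}^{\perp}$ is a $p$-ary linear code of length $p^n-1$, dimension $4m$ and minimum distance $(p^m-p^{m-1})\left(p^m+1-\frac{3l}{2}\right)$. It has exactly four nonzero weights, and its weight distribution (the number of codewords of each Hamming weight) is as follows: - weight $0$: $1$ codeword; - weight $(p^m-p^{m-1})\left(p^m+1-\frac{3l}{2}\right)$: $\dfrac{2(p^{2m}-1)(l-p^m-1)(l-2p^m-2)}{3l^3}$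 codewords; - weight $(p^m-p^{m-1})(p^m+1-l)$: $\dfrac{(p^{2m}-1)\left(2p^m+2-(p^m+3)l\right)(l-2p^m-2)}{l^3}$ codewords; - weight $(p^m-p^{m-1})\left(p^m+1-\frac{l}{2}\right)$: $\dfrac{2(p^{2m}-1)\left((p^{2m}+2p^m+3)l^2-(2p^{2m}+7p^m+5)l+2(p^m+1)^2\right)}{l^3}$ codewords; - weight $(p^m-p^{m-1})(p^m+1)$: $\dfrac{(p^{2m}-1)\left(3(p^{2m}+1)l^3-(6p^{2m}+9p^m+11)l^2+6(p^{2m}+3p^m+2)l-4(p^m+1)^2\right)}{3l^3}$ codewords; and there are no codewords of any other weight. -/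

import Mathlib

open Polynomial

noncomputable section

/-- The cyclic code of length `N` over `K` generated by `g`: the words `(c₀, …, c_{N-1})` for which
the class of `∑ cᵢ Xⁱ` lies in the ideal `(g)` of `K[X]/(X^N - 1)`. -/
def cyclicCode (K : Type*) [Field K] [DecidableEq K] (N : ℕ) (g : K[X]) :
    Submodule K (Fin N → K) :=
  ((Ideal.span {AdjoinRoot.mk (X ^ N - 1 : K[X]) g}).restrictScalars K).comap
    ((AdjoinRoot.mkₐ (X ^ N - 1 : K[X])).toLinearMap ∘ₗ Polynomial.ofFn N)

/-- The dual of a linear code with respect to the standard bilinear form. -/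
def dualCode {K : Type*} [Field K] {N : ℕ} (C : Submodule K (Fin N → K)) :
    Submodule K (Fin N → K) where
  carrier := {x | ∀ c ∈ C, ∑ i, x i * c i = 0}
  zero_mem' := by
    intro c _
    simp
  add_mem' := by
    intro x y hx hy c hc
    simp only [Pi.add_apply, add_mul, Finset.sum_add_distrib, hx c hc, hy c hc, add_zero]
  smul_mem' := by
    intro a x hx c hc
    simp only [Pi.smul_apply, smul_eq_mul, mul_assoc, ← Finset.mul_sum, hx c hc, mul_zero]

/-- The cyclic code over `𝔽_p` of length `N` with the two zeros `θ ^ d₁` and `θ ^ d₂`: its generator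
polynomial is the product of the minimal polynomials of `θ ^ d₁` and `θ ^ d₂` over `𝔽_p`. -/
def twoZeroCode (p : ℕ) [Fact p.Prime] {F : Type*} [Field F] [Algebra (ZMod p) F]
    (N : ℕ) (θ : F) (d₁ d₂ : ℕ) : Submodule (ZMod p) (Fin N → ZMod p) :=
  cyclicCode (ZMod p) N (minpoly (ZMod p) (θ ^ d₁) * minpoly (ZMod p) (θ ^ d₂))

/-- The number of codewords of Hamming weight `w`. -/
def weightCount {K : Type*} [Field K] [DecidableEq K] {N : ℕ}
    (C : Submodule K (Fin N → K)) (w : ℕ) : ℕ :=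
  Set.ncard {c : Fin N → K | c ∈ C ∧ hammingNorm c = w}

/-- `C` has minimum distance `d`: the least Hamming distance between distinct codewords is `d`. -/
def HasMinDist {K : Type*} [Field K] [DecidableEq K] {N : ℕ}
    (C : Submodule K (Fin N → K)) (d : ℕ) : Prop :=
  IsLeast {e : ℕ | ∃ x ∈ C, ∃ y ∈ C, x ≠ y ∧ hammingDist x y = e} d

end

/-! Write q = p^m, t = 2k with k = 2r + 1 odd, and g = gcd(q + 1, k), so that l = 2g. By Delsarte
(`dualCode_cyclicCode_minpoly_mul`) the dual code consists of the words Tr(a x^{d₁} + b x^{d₂}),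
with x running over the units of F.

Both exponents are of Niho type, congruent to 1 modulo q - 1, so scaling x by an element of 𝔽_qˣ
scales the argument of the trace. The weight is therefore governed by the cosets of 𝔽_qˣ on which
the relative trace to 𝔽_q is nonzero (`card_trace_ne_zero_mul`). Up to a nonzero factor this
relative trace is the cubic b w³ + a w² + a^q w + b^q at w = x^{(q-1)k}
(`add_pow_ne_zero_iff_conjCubic_ne_zero`). These w fill a subgroup H of order M = (q + 1)/g of the
(q + 1)-th roots of unity. A cubic with j roots in H thus gives weight (q - q/p) g (M - j), and j ≤
3 unless (a, b) = 0 (`hammingNorm_traceWord`).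

It remains to count the pairs (a, b) for each j. At a fixed w in H the cubic is additive in (a, b)
and takes at most q values, while any four points of H determine (a, b) among q⁴ pairs. So vanishing
at i ≤ 4 points leaves exactly q^{4-i} pairs, and the binomial moments of j are C(M, i) q^{4-i}
(`sum_choose_rootCount`). These moments determine the four frequencies. The condition on t gives M ≥
4, which makes the encoding injective and all four frequencies positive (`pos_of_moment_equations`).
-/

/-! ### Additive maps in general position and binomial moments -/

/-- Subtracting a fixed member of a fibre embeds that fibre into the zero fibre; closure of `K`
under differences is all that this needs. -/
lemma Finset.card_le_mul_card_filter_eq_zero {G A : Type*} [AddCommGroup G] [AddCommGroup A]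
    [DecidableEq A] (φ : G →+ A) (K : Finset G) (hK : ∀ x ∈ K, ∀ y ∈ K, x - y ∈ K)
    (B : Finset A) (hB : ∀ x ∈ K, φ x ∈ B) :
    K.card ≤ (K.filter fun x => φ x = 0).card * B.card := by
  refine Finset.card_le_mul_card_image_of_maps_to hB _ fun b _ => ?_
  obtain h | ⟨y, hy⟩ := (K.filter fun x => φ x = b).eq_empty_or_nonempty
  · simp [h]
  · rw [Finset.mem_filter] at hy
    refine Finset.card_le_card_of_injOn (fun x => x - y) (fun x hx => ?_)
      (sub_left_injective.injOn)
    simp only [Finset.coe_filter, Set.mem_ofPred_eq] at hx ⊢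
    exact ⟨hK x hx.1 y hy.1, by rw [map_sub, hx.2, hy.2, sub_self]⟩

section CommonZeros

variable {V A W : Type*} [AddCommGroup V] [Fintype V] [AddCommGroup A]
  [DecidableEq A] [DecidableEq W]

lemma card_commonZeros_le_mul (φ : W → V →+ A) (q : ℕ) (S : Finset W) (w : W) (B : Finset A)
    (hB : B.card ≤ q) (hφ : ∀ v, φ w v ∈ B) :
    (Finset.univ.filter fun v => ∀ x ∈ S, φ x v = 0).card ≤
      (Finset.univ.filter fun v => ∀ x ∈ insert w S, φ x v = 0).card * q := by
  refine (Finset.card_le_mul_card_filter_eq_zero (φ w) _ ?_ B fun v _ => hφ v).trans ?_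
  · intro x hx y hy
    simp only [Finset.mem_filter, Finset.mem_univ, true_and] at hx hy ⊢
    intro z hz
    rw [map_sub, hx z hz, hy z hz, sub_self]
  · refine Nat.mul_le_mul (Finset.card_le_card fun v hv => ?_) hB
    simp only [Finset.mem_filter, Finset.mem_univ, true_and, Finset.mem_insert,
      forall_eq_or_imp] at hv ⊢
    exact ⟨hv.2, hv.1⟩

variable (φ : W → V →+ A) (H : Finset W) (q d : ℕ) (hq : 0 < q)
  (hmap : ∀ w ∈ H, ∃ B : Finset A, B.card ≤ q ∧ ∀ v, φ w v ∈ B)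
  (hV : Fintype.card V = q ^ d)
  (hinj : ∀ S ⊆ H, S.card = d → ∀ v, (∀ w ∈ S, φ w v = 0) → v = 0) (hd : d ≤ H.card)
include hq hmap hV hinj hd

/-- Additive maps with at most `q` values on a group of order `q ^ d`, any `d` of which have
trivial common kernel, are in general position. -/
lemma card_commonZeros (S : Finset W) (hS : S ⊆ H) (hSd : S.card ≤ d) :
    (Finset.univ.filter fun v => ∀ x ∈ S, φ x v = 0).card = q ^ (d - S.card) := by
  apply le_antisymm
  -- Upper bound: enlarge `S` inside `H` up to `d` points, where only 0 survives; each added point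
  -- costs a factor of at most `q`.
  · obtain ⟨k, hk⟩ : ∃ k, k = d - S.card := ⟨_, rfl⟩
    rw [← hk]
    induction k generalizing S with
    | zero =>
      rw [pow_zero, Finset.card_le_one]
      intro a ha b hb
      simp only [Finset.mem_filter, Finset.mem_univ, true_and] at ha hb
      rw [hinj S hS (by omega) a ha, hinj S hS (by omega) b hb]
    | succ k ih =>
      obtain ⟨w, hwH, hwS⟩ := Finset.exists_mem_notMem_of_card_lt_card
        (show S.card < H.card by omega)
      obtain ⟨B, hB, hφ⟩ := hmap w hwH
      have hc := Finset.card_insert_of_notMem hwS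
      refine (card_commonZeros_le_mul φ q S w B hB hφ).trans ?_
      rw [pow_succ]
      exact Nat.mul_le_mul_right _
        (ih _ (Finset.insert_subset hwH hS) (by omega) (by omega))
  -- Lower bound: build `S` up from the empty set, losing at most a factor `q` per point.
  · have key : q ^ d ≤ (Finset.univ.filter fun v => ∀ x ∈ S, φ x v = 0).card * q ^ S.card := by
      clear hSd
      induction S using Finset.induction_on with
      | empty => simp [hV]
      | insert w S hw ih =>
        obtain ⟨B, hB, hφ⟩ := hmap w (hS (Finset.mem_insert_self _ _))
        refine (ih ((Finset.subset_insert _ _).trans hS)).trans ?_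
        rw [Finset.card_insert_of_notMem hw, pow_succ', ← mul_assoc]
        exact Nat.mul_le_mul_right _ (card_commonZeros_le_mul φ q S w B hB hφ)
    refine Nat.le_of_mul_le_mul_right ?_ (pow_pos hq S.card)
    rwa [← pow_add, Nat.sub_add_cancel hSd]

/-- Double counting of the pairs (`v`, `S`) with `S` an `i`-subset of `H` on which `v` vanishes. -/
lemma sum_choose_card_zeros (i : ℕ) (hi : i ≤ d) :
    ∑ v : V, ((H.filter fun w => φ w v = 0).card).choose i = H.card.choose i * q ^ (d - i) := by
  classical
  have h1 : ∀ v : V, ((H.filter fun w => φ w v = 0).card).choose i =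
      ((H.powersetCard i).filter fun S => ∀ x ∈ S, φ x v = 0).card := by
    intro v
    rw [← Finset.card_powersetCard]
    congr 1
    ext S
    simp only [Finset.mem_powersetCard, Finset.mem_filter, Finset.subset_iff]
    grind
  have h2 := Finset.sum_card_bipartiteAbove_eq_sum_card_bipartiteBelow
    (fun (v : V) (S : Finset W) => ∀ x ∈ S, φ x v = 0) (s := Finset.univ)
    (t := H.powersetCard i)
  simp only [Finset.bipartiteAbove, Finset.bipartiteBelow] at h2
  rw [Finset.sum_congr rfl fun v _ => h1 v, h2, ← Finset.card_powersetCard, ← smul_eq_mul,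
    ← Finset.sum_const]
  refine Finset.sum_congr rfl fun S hS => ?_
  rw [Finset.mem_powersetCard] at hS
  rw [card_commonZeros φ H q d hq hmap hV hinj hd S hS.1 (hS.2.trans_le hi), hS.2]

end CommonZeros

/-- The number of elements with a given number of zeros is determined by the binomial moments. -/
lemma card_filter_eq_of_sum_choose {V : Type*} [Fintype V] [DecidableEq V] [Zero V] (j : V → ℕ)
    (M q : ℕ) (h0 : j 0 = M) (hj : ∀ v, v ≠ 0 → j v ≤ 3)
    (hsum : ∀ i ≤ 4, ∑ v, (j v).choose i = M.choose i * q ^ (4 - i)) :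
    let n : ℕ → ℚ := fun i => ((Finset.univ.filter fun v : V => v ≠ 0 ∧ j v = i).card : ℚ)
    n 3 = M * (M - 1) * (M - 2) / 6 * (q - 1) ∧
    n 2 + 3 * n 3 = M * (M - 1) / 2 * (q ^ 2 - 1) ∧
    n 1 + 2 * n 2 + 3 * n 3 = M * (q ^ 3 - 1) ∧
    n 0 + n 1 + n 2 + n 3 = q ^ 4 - 1 := by
  intro n
  have hn : ∀ i, n i = ∑ v ∈ Finset.univ.erase (0 : V), if j v = i then (1 : ℚ) else 0 := by
    intro i
    rw [Finset.sum_boole, ← Finset.filter_ne' , Finset.filter_filter]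
  -- Removing `v = 0`, where `j` equals `M`, subtracts C(M, i) from the i-th moment.
  have hs : ∀ i ≤ 4, ∑ v ∈ Finset.univ.erase (0 : V), ((j v).choose i : ℚ) =
      M.choose i * (q ^ (4 - i) - 1) := by
    intro i hi
    have := hsum i hi
    rw [← Finset.add_sum_erase _ _ (Finset.mem_univ (0 : V)), h0] at this
    have h' : ((M.choose i : ℚ) + ∑ v ∈ Finset.univ.erase (0 : V), ((j v).choose i : ℚ)) =
      M.choose i * q ^ (4 - i) := by exact_mod_cast this
    linarith
  have hle : ∀ v ∈ Finset.univ.erase (0 : V), j v ≤ 3 := fun v hv =>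
    hj v (Finset.ne_of_mem_erase hv)
  generalize Finset.univ.erase (0 : V) = E at hn hs hle
  have c3 : (M.choose 3 : ℚ) = M * (M - 1) * (M - 2) / 6 := by
    rw [Nat.cast_choose_eq_descPochhammer_div]
    simp [descPochhammer_succ_eval, Nat.factorial]
    try ring
  have c2 : (M.choose 2 : ℚ) = M * (M - 1) / 2 := Nat.cast_choose_two ℚ M
  have h0 := hs 0 (by norm_num)
  have h1 := hs 1 (by norm_num)
  have h2 := hs 2 (by norm_num)
  have h3 := hs 3 (by norm_num)
  rw [c2] at h2
  rw [c3] at h3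
  simp only [Nat.choose_zero_right, Nat.choose_one_right, Nat.cast_one, one_mul] at h0 h1
  norm_num at h0 h1 h2 h3
  refine ⟨?_, ?_, ?_, ?_⟩
  · rw [← h3, hn]
    refine Finset.sum_congr rfl fun v hv => ?_
    have := hle v hv
    interval_cases j v <;> norm_num [Nat.choose]
  · rw [← h2, hn, hn, Finset.mul_sum, ← Finset.sum_add_distrib]
    refine Finset.sum_congr rfl fun v hv => ?_
    have := hle v hv
    interval_cases j v <;> norm_num [Nat.choose]
  · rw [← h1, hn, hn, hn, Finset.mul_sum, Finset.mul_sum, ← Finset.sum_add_distrib,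
      ← Finset.sum_add_distrib]
    refine Finset.sum_congr rfl fun v hv => ?_
    have := hle v hv
    interval_cases j v <;> norm_num
  · have h0' : (q : ℚ) ^ 4 - 1 = ∑ v ∈ E, (1 : ℚ) := by
      rw [← h0]; simp
    rw [h0', hn, hn, hn, hn, ← Finset.sum_add_distrib, ← Finset.sum_add_distrib,
      ← Finset.sum_add_distrib]
    refine Finset.sum_congr rfl fun v hv => ?_
    have := hle v hv
    interval_cases j v <;> norm_num

/-! ### Delsarte duality and trace words -/

section Delsarte

variable {K : Type*} [Field K] {N : ℕ}

lemma dualCode_dualCode (T : Submodule K (Fin N → K)) : dualCode (dualCode T) = T := by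
  let B : LinearMap.BilinForm K (Fin N → K) := dotProductBilin K K
  have hBa : ∀ x y, B x y = ∑ i, x i * y i := fun x y => rfl
  have hsymm : ∀ x y, B x y = B y x := fun x y => by simp only [hBa, mul_comm]
  have hB : B.Nondegenerate := by
    refine ⟨fun x hx => dotProduct_eq_zero x hx, fun x hx => dotProduct_eq_zero x fun y => ?_⟩
    exact (hsymm x y).trans (hx y)
  have hr : B.IsRefl := fun x y h => by rw [hsymm, h]
  have hd : ∀ S : Submodule K (Fin N → K), dualCode S = B.orthogonal S := by
    intro S
    ext x
    rw [LinearMap.BilinForm.mem_orthogonal_iff]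
    exact forall₂_congr fun c _ => by rw [← hBa, hsymm]
  rw [hd, hd, LinearMap.BilinForm.orthogonal_orthogonal hB hr]

lemma mem_cyclicCode_iff [DecidableEq K] {g : K[X]} (hg : g ∣ X ^ N - 1) (c : Fin N → K) :
    c ∈ cyclicCode K N g ↔ g ∣ ofFn N c := by
  change AdjoinRoot.mk _ (ofFn N c) ∈ Ideal.span {AdjoinRoot.mk (X ^ N - 1 : K[X]) g} ↔ _
  rw [Ideal.mem_span_singleton]
  constructor
  · rintro ⟨y, hy⟩
    obtain ⟨y, rfl⟩ := AdjoinRoot.mk_surjective y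
    rw [← map_mul, AdjoinRoot.mk_eq_mk] at hy
    exact (dvd_sub_left (dvd_mul_right g y)).1 (hg.trans hy)
  · exact fun h => map_dvd _ h

lemma aeval_ofFn [DecidableEq K] {F : Type*} [Field F] [Algebra K F] (c : Fin N → K) (x : F) :
    aeval x (ofFn N c) = ∑ i, c i • x ^ (i : ℕ) := by
  rw [ofFn_eq_sum_monomial, map_sum]
  exact Finset.sum_congr rfl fun i _ => by rw [aeval_monomial, Algebra.smul_def]

variable {F : Type*} [Field F] [Algebra K F]

/-- The map sending `(a, b)` to the word `(Tr (a xⁱ + b yⁱ))ᵢ`. -/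
noncomputable def traceWord (K : Type*) [Field K] {F : Type*} [Field F] [Algebra K F] (N : ℕ)
    (x y : F) : F × F →ₗ[K] (Fin N → K) where
  toFun v i := Algebra.trace K F (v.1 * x ^ (i : ℕ) + v.2 * y ^ (i : ℕ))
  map_add' v w := by
    ext i
    simp only [Prod.fst_add, Prod.snd_add, Pi.add_apply, ← map_add]
    congr 1
    ring
  map_smul' r v := by
    ext i
    simp only [Prod.smul_fst, Prod.smul_snd, Pi.smul_apply, RingHom.id_apply, ← map_smul]
    congr 1
    rw [smul_add, smul_mul_assoc, smul_mul_assoc]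

lemma traceWord_apply (x y : F) (v : F × F) (i : Fin N) :
    traceWord K N x y v i = Algebra.trace K F (v.1 * x ^ (i : ℕ) + v.2 * y ^ (i : ℕ)) := rfl

lemma sum_traceWord_mul (x y : F) (v : F × F) (c : Fin N → K) :
    ∑ i, traceWord K N x y v i * c i =
      Algebra.trace K F (v.1 * (∑ i, c i • x ^ (i : ℕ)) + v.2 * (∑ i, c i • y ^ (i : ℕ))) := by
  rw [Finset.mul_sum, Finset.mul_sum, ← Finset.sum_add_distrib, map_sum]
  refine Finset.sum_congr rfl fun i _ => ?_
  rw [mul_smul_comm, mul_smul_comm, ← smul_add, map_smul, smul_eq_mul, mul_comm,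
    traceWord_apply]

/-- Nondegeneracy of the trace form, tested on the coefficient pairs (a, 0) and (0, a). -/
lemma mem_dualCode_range_traceWord [FiniteDimensional K F] [Algebra.IsSeparable K F] (x y : F)
    (c : Fin N → K) : c ∈ dualCode (LinearMap.range (traceWord K N x y)) ↔
      ∑ i, c i • x ^ (i : ℕ) = 0 ∧ ∑ i, c i • y ^ (i : ℕ) = 0 := by
  have hnd := (traceForm_nondegenerate K F).2
  change (∀ w ∈ LinearMap.range (traceWord K N x y), ∑ i, c i * w i = 0) ↔ _
  simp only [LinearMap.mem_range, forall_exists_index, forall_apply_eq_imp_iff, mul_comm (c _),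
    sum_traceWord_mul]
  constructor
  · intro h
    refine ⟨hnd _ fun a => ?_, hnd _ fun a => ?_⟩
    · rw [Algebra.traceForm_apply]
      simpa only [zero_mul, add_zero] using h (a, 0)
    · rw [Algebra.traceForm_apply]
      simpa only [zero_mul, zero_add] using h (0, a)
  · rintro ⟨h1, h2⟩ v
    rw [h1, h2]
    simp

/-- If the trace words of `x, y` depend injectively on the coefficients, then `x` and `y` are not
conjugate. -/
lemma minpoly_ne_of_injective_traceWord [FiniteDimensional K F] [IsGalois K F] {x y : F}
    (h : Function.Injective (traceWord K N x y)) : minpoly K x ≠ minpoly K y := by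
  intro hxy
  obtain ⟨σ, hσ⟩ := IsConjRoot.exists_algEquiv (K := K) (L := F) hxy
  -- The trace is Galois invariant, so conjugate elements produce the same trace word.
  have h0 : traceWord K N x y (-1, 1) = 0 := by
    ext i
    rw [traceWord_apply, ← hσ, ← map_pow, map_add, neg_one_mul, one_mul, map_neg,
      Algebra.trace_eq_of_algEquiv, neg_add_cancel, Pi.zero_apply]
  have := congrArg Prod.snd (h (h0.trans (map_zero _).symm))
  exact one_ne_zero this

/-- Delsarte's description of the dual of a cyclic code with two non-conjugate zeros. -/
lemma dualCode_cyclicCode_minpoly_mul [DecidableEq K] [FiniteDimensional K F] [IsGalois K F]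
    {x y : F} (hx : x ^ N = 1) (hy : y ^ N = 1)
    (h : Function.Injective (traceWord K N x y)) :
    dualCode (cyclicCode K N (minpoly K x * minpoly K y)) =
      LinearMap.range (traceWord K N x y) := by
  have hxi := Algebra.IsIntegral.isIntegral (R := K) x
  have hyi := Algebra.IsIntegral.isIntegral (R := K) y
  have hcop : IsCoprime (minpoly K x) (minpoly K y) := by
    rw [(minpoly.irreducible hxi).coprime_iff_not_dvd]
    intro hdvd
    exact minpoly_ne_of_injective_traceWord h
      (eq_of_monic_of_associated (minpoly.monic hxi) (minpoly.monic hyi)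
        ((minpoly.irreducible hxi).associated_of_dvd (minpoly.irreducible hyi) hdvd))
  have hdvd : minpoly K x * minpoly K y ∣ X ^ N - 1 :=
    hcop.mul_dvd (minpoly.dvd _ _ (by simp [hx])) (minpoly.dvd _ _ (by simp [hy]))
  rw [← dualCode_dualCode (LinearMap.range (traceWord K N x y))]
  congr 1
  ext c
  rw [mem_cyclicCode_iff hdvd, mem_dualCode_range_traceWord, ← aeval_ofFn, ← aeval_ofFn,
    ← minpoly.dvd_iff, ← minpoly.dvd_iff]
  exact ⟨fun hc => ⟨(dvd_mul_right _ _).trans hc, (dvd_mul_left _ _).trans hc⟩,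
    fun hc => hcop.mul_dvd hc.1 hc.2⟩

end Delsarte

/-! ### Counting roots and fibres of homomorphisms -/

lemma card_filter_eval_eq_zero_le {F : Type*} [Field F] [Fintype F] [DecidableEq F] {f : F[X]}
    (hf : f ≠ 0) {d : ℕ} (hd : f.natDegree ≤ d) :
    (Finset.univ.filter fun x => f.eval x = 0).card ≤ d := by
  refine le_trans ?_ (f.card_roots'.trans hd)
  refine le_trans (Finset.card_le_card fun x hx => ?_) (Multiset.toFinset_card_le _)
  rw [Finset.mem_filter] at hx
  rw [Multiset.mem_toFinset, mem_roots hf]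
  exact hx.2

lemma card_filter_monoidHom {G G' : Type*} [Group G] [Fintype G] [Group G'] [DecidableEq G']
    (f : G →* G') (P : G' → Prop) [DecidablePred P] :
    (Finset.univ.filter fun x => P (f x)).card =
      Nat.card f.ker * ((Finset.univ.image f).filter P).card := by
  classical
  rw [Finset.card_eq_sum_card_fiberwise (f := f) (t := (Finset.univ.image f).filter P)]
  · rw [mul_comm, ← smul_eq_mul, ← Finset.sum_const]
    refine Finset.sum_congr rfl fun w hw => ?_
    rw [Finset.mem_filter, Finset.mem_image] at hw
    obtain ⟨⟨x, -, rfl⟩, hP⟩ := hw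
    have h1 := MonoidHom.card_fiber_eq_of_mem_range f (x := f x) (y := 1) ⟨x, rfl⟩ ⟨1, map_one f⟩
    rw [Finset.filter_filter]
    have h2 : (Finset.univ.filter fun a => P (f a) ∧ f a = f x) =
        Finset.univ.filter fun a => f a = f x := by
      refine Finset.filter_congr fun a _ => ⟨fun h => h.2, fun h => ⟨h ▸ hP, h⟩⟩
    rw [h2, h1]
    exact (Nat.subtype_card _ fun x => by simp [MonoidHom.mem_ker]).symm
  · intro x hx
    simp only [Finset.coe_filter, Set.mem_ofPred_eq, Finset.mem_univ, true_and,
      Finset.mem_image] at hx ⊢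
    exact ⟨⟨x, rfl⟩, hx⟩

/-! ### The conjugate-reciprocal cubic over a quadratic extension -/

section QuadraticExtension

set_option linter.unusedSectionVars false

variable {p : ℕ} [Fact p.Prime] {F : Type*} [Field F] [CharP F p] (m : ℕ)

variable (p) in
/-- The value at `w` of the self-conjugate-reciprocal cubic `b X³ + a X² + aᵠ X + bᵠ`, `q = p ^ m`,
as an additive function of `(a, b)`. -/
noncomputable def conjCubic (w : F) : F × F →+ F :=
  AddMonoidHom.mk' (fun v => v.2 * w ^ 3 + v.1 * w ^ 2 + v.1 ^ p ^ m * w + v.2 ^ p ^ m) (by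
    intro x y
    simp only [Prod.fst_add, Prod.snd_add, add_pow_char_pow]
    ring)

lemma conjCubic_apply (w : F) (v : F × F) : conjCubic p m w v =
    v.2 * w ^ 3 + v.1 * w ^ 2 + v.1 ^ p ^ m * w + v.2 ^ p ^ m := rfl

/-- A polynomial of degree at most 3 with four roots vanishes, and its two top coefficients are the
entries of `v`. -/
lemma eq_zero_of_conjCubic_eq_zero (S : Finset F) (hS : S.card = 4) (v : F × F)
    (h : ∀ w ∈ S, conjCubic p m w v = 0) : v = 0 := by
  let f : F[X] := C v.2 * X ^ 3 + C v.1 * X ^ 2 + C (v.1 ^ p ^ m) * X + C (v.2 ^ p ^ m)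
  have hf : f = 0 := by
    refine eq_zero_of_degree_lt_of_eval_finset_eq_zero S ?_ fun w hw => ?_
    · rw [hS]
      have : f.degree ≤ 3 := degree_cubic_le
      exact this.trans_lt (by norm_num)
    · simpa [f, conjCubic_apply] using h w hw
  have h3 : f.coeff 3 = v.2 := by
    simp [f, -map_pow]
  have h2 : f.coeff 2 = v.1 := by
    simp [f, -map_pow]
  rw [hf, coeff_zero] at h2 h3
  exact Prod.ext h2.symm h3.symm

variable [Fintype F] (hm : 1 ≤ m) (hF : Fintype.card F = p ^ (2 * m))

include hF in
lemma pow_pow_mul_two_self (x : F) : (x ^ p ^ m) ^ p ^ m = x := by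
  rw [← pow_mul, ← pow_add, ← two_mul, ← hF, FiniteField.pow_card]

include hF in
-- Since w^q = w⁻¹, the q-th power map reverses the coefficients of the cubic.
lemma conjCubic_pow_mul {w : F} (hw : w ^ (p ^ m + 1) = 1) (v : F × F) :
    (conjCubic p m w v) ^ p ^ m * w ^ 3 = conjCubic p m w v := by
  rw [pow_succ] at hw
  simp only [conjCubic_apply, add_pow_char_pow, mul_pow, pow_pow_mul_two_self m hF, ← pow_mul,
    mul_comm _ (p ^ m)]
  simp only [pow_mul]
  generalize w ^ p ^ m = z at hw
  linear_combination (v.2 ^ p ^ m * (z ^ 2 * w ^ 2 + z * w + 1) +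
    v.1 ^ p ^ m * w * (z * w + 1) + v.1 * w ^ 2) * hw

include hF hm in
-- By `conjCubic_pow_mul` every value is a root of w³ X^q - X, which has degree q.
lemma exists_card_le_conjCubic_mem {w : F} (hw : w ^ (p ^ m + 1) = 1) :
    ∃ B : Finset F, B.card ≤ p ^ m ∧ ∀ v, conjCubic p m w v ∈ B := by
  classical
  have hp := (Fact.out : p.Prime)
  have hw0 : w ≠ 0 := by rintro rfl; simp at hw
  have hq : 1 < p ^ m := Nat.one_lt_pow (by omega) hp.one_lt
  let f : F[X] := C (w ^ 3) * X ^ p ^ m - X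
  have hf : f ≠ 0 := by
    intro h
    have : f.coeff (p ^ m) = w ^ 3 := by
      simp [f, coeff_X, hq.ne, -map_pow]
    rw [h, coeff_zero] at this
    exact pow_ne_zero 3 hw0 this.symm
  refine ⟨_, card_filter_eval_eq_zero_le hf (d := p ^ m) ?_, fun v => ?_⟩
  · refine (natDegree_sub_le _ _).trans (max_le (natDegree_C_mul_X_pow_le _ _) ?_)
    exact natDegree_X_le.trans hq.le
  · simp only [Finset.mem_filter, Finset.mem_univ, true_and, f, eval_sub, eval_mul, eval_C,
      eval_pow, eval_X]
    rw [mul_comm, conjCubic_pow_mul m hF hw, sub_self]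

include hF in
lemma natCard_units_eq : Nat.card Fˣ = (p ^ m - 1) * (p ^ m + 1) := by
  classical
  rw [Nat.card_eq_fintype_card, Fintype.card_units, hF, mul_comm (p ^ m - 1), ← Nat.sq_sub_sq,
    one_pow, ← pow_mul, mul_comm]

include hF in
lemma card_filter_units_pow_eq_one [DecidableEq F] :
    (Finset.univ.filter fun y : Fˣ => y ^ (p ^ m - 1) = 1).card = p ^ m - 1 := by
  have h := IsCyclic.card_powMonoidHom_ker Fˣ (p ^ m - 1)
  rw [natCard_units_eq m hF, Nat.gcd_mul_right_left] at h
  exact (Nat.subtype_card _ fun x => by simp [MonoidHom.mem_ker]).symm.trans h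

variable (p) in
lemma units_pow_sub_one_eq_one_iff (y : Fˣ) : y ^ (p ^ m - 1) = 1 ↔ (y : F) ^ p ^ m = y := by
  have hq : p ^ m - 1 + 1 = p ^ m := Nat.sub_add_cancel (pow_pos (Fact.out : p.Prime).pos m)
  rw [← Units.val_inj, Units.val_pow_eq_pow_val, Units.val_one]
  constructor
  · intro h
    rw [← hq, pow_succ, h, one_mul]
  · intro h
    rw [← hq, pow_succ] at h
    exact mul_right_cancel₀ y.ne_zero (h.trans (one_mul _).symm)

lemma filter_pow_eq_self [DecidableEq F] : (Finset.univ.filter fun y : F => y ^ p ^ m = y) =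
    insert 0 ((Finset.univ.filter fun y : Fˣ => y ^ (p ^ m - 1) = 1).map
      ⟨Units.val, Units.val_injective⟩) := by
  ext y
  simp only [Finset.mem_filter, Finset.mem_univ, true_and, Finset.mem_insert, Finset.mem_map,
    units_pow_sub_one_eq_one_iff p, Function.Embedding.coeFn_mk]
  constructor
  · intro h
    by_cases hy : y = 0
    · exact Or.inl hy
    · exact Or.inr ⟨Units.mk0 y hy, h, rfl⟩
  · rintro (rfl | ⟨x, hx, rfl⟩)
    · exact zero_pow (pow_pos (Fact.out : p.Prime).pos m).ne'
    · exact hx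

include hF in
lemma card_filter_pow_eq_self [DecidableEq F] :
    (Finset.univ.filter fun y : F => y ^ p ^ m = y).card = p ^ m := by
  rw [filter_pow_eq_self, Finset.card_insert_of_notMem (by simp), Finset.card_map,
    card_filter_units_pow_eq_one m hF]
  exact Nat.sub_add_cancel (pow_pos (Fact.out : p.Prime).pos m)

/-! ### Absolute traces along the subfield of order q -/

section Trace

variable [Algebra (ZMod p) F]

include hF in
-- Transitivity of the trace through 𝔽_q: conjugates i and m + i pair up because y is fixed by the
-- q-th power map.
lemma algebraMap_trace_mul {y : F} (hy : y ^ p ^ m = y) (u : F) :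
    algebraMap (ZMod p) F (Algebra.trace (ZMod p) F (y * u)) =
      ∑ i ∈ Finset.range m, (u + u ^ p ^ m) ^ p ^ i * y ^ p ^ i := by
  have hfr : Module.finrank (ZMod p) F = m + m := by
    have h := Module.card_eq_pow_finrank (K := ZMod p) (V := F)
    rw [hF, ZMod.card] at h
    have := Nat.pow_right_injective (Fact.out : p.Prime).two_le h
    omega
  rw [FiniteField.algebraMap_trace_eq_sum_pow, hfr, Nat.card_zmod, Finset.sum_range_add,
    ← Finset.sum_add_distrib]
  refine Finset.sum_congr rfl fun i _ => ?_
  rw [pow_add, pow_mul, mul_pow y u (p ^ m), hy, add_pow_char_pow, mul_pow, mul_pow]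
  ring

include hF hm in
lemma card_filter_trace_mul_eq_zero [DecidableEq F] {u : F} (hu : u + u ^ p ^ m ≠ 0) :
    ((Finset.univ.filter fun y : F => y ^ p ^ m = y).filter fun y =>
      Algebra.trace (ZMod p) F (y * u) = 0).card = p ^ (m - 1) := by
  have hp := (Fact.out : p.Prime)
  apply le_antisymm
  -- Upper bound: on 𝔽_q the trace is given by this polynomial, of degree p^{m-1} because its
  -- leading coefficient is a power of u + u^q.
  · let f : F[X] := ∑ i ∈ Finset.range m, C ((u + u ^ p ^ m) ^ p ^ i) * X ^ p ^ i
    have hf : f ≠ 0 := by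
      intro h
      have hc : f.coeff (p ^ (m - 1)) = (u + u ^ p ^ m) ^ p ^ (m - 1) := by
        simp only [f, finsetSum_coeff, coeff_C_mul, coeff_X_pow]
        rw [Finset.sum_eq_single (m - 1)]
        · simp
        · intro i _ hi
          rw [if_neg, mul_zero]
          exact fun h => hi (Nat.pow_right_injective hp.two_le h).symm
        · intro h
          exact absurd (Finset.mem_range.2 (by omega)) h
      rw [h, coeff_zero] at hc
      exact pow_ne_zero _ hu hc.symm
    refine le_trans (Finset.card_le_card fun y hy => ?_)
      (card_filter_eval_eq_zero_le hf (d := p ^ (m - 1)) ?_)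
    · simp only [Finset.mem_filter, Finset.mem_univ, true_and] at hy ⊢
      simp only [f, eval_finsetSum, eval_mul, eval_C, eval_pow, eval_X]
      rw [← algebraMap_trace_mul m hF hy.1, hy.2, map_zero]
    · refine natDegree_sum_le_of_forall_le _ _ fun i hi => ?_
      refine (natDegree_C_mul_X_pow_le _ _).trans (Nat.pow_le_pow_right hp.pos ?_)
      rw [Finset.mem_range] at hi
      omega
  -- Lower bound: the trace takes at most p values on the q elements of 𝔽_q.
  · have h := Finset.card_le_mul_card_filter_eq_zero
      (AddMonoidHom.mk' (fun y => Algebra.trace (ZMod p) F (y * u))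
        (fun x y => by rw [add_mul, map_add]))
      (Finset.univ.filter fun y : F => y ^ p ^ m = y) (by
        intro x hx y hy
        simp only [Finset.mem_filter, Finset.mem_univ, true_and] at hx hy ⊢
        rw [sub_pow_char_pow, hx, hy]) Finset.univ (fun _ _ => Finset.mem_univ _)
    rw [card_filter_pow_eq_self m hF, Finset.card_univ, ZMod.card] at h
    refine Nat.le_of_mul_le_mul_right ?_ hp.pos
    rw [← pow_succ, Nat.sub_add_cancel hm]
    exact h

include hF hm in
lemma card_filter_units_trace_mul_ne_zero [DecidableEq F] (u : F) :
    ((Finset.univ.filter fun y : Fˣ => y ^ (p ^ m - 1) = 1).filter fun y : Fˣ =>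
      Algebra.trace (ZMod p) F ((y : F) * u) ≠ 0).card =
        if u + u ^ p ^ m ≠ 0 then p ^ m - p ^ (m - 1) else 0 := by
  split_ifs with hu
  · have h := Finset.card_filter_add_card_filter_not
      (s := Finset.univ.filter fun y : F => y ^ p ^ m = y)
      (fun y => Algebra.trace (ZMod p) F (y * u) = 0)
    rw [card_filter_trace_mul_eq_zero m hm hF hu, card_filter_pow_eq_self m hF,
      filter_pow_eq_self, Finset.filter_insert, if_neg (by simp), Finset.filter_map,
      Finset.card_map] at h
    exact Nat.eq_sub_of_add_eq' h
  · rw [not_not] at hu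
    rw [Finset.card_eq_zero, Finset.filter_eq_empty_iff]
    intro y hy
    rw [Finset.mem_filter, units_pow_sub_one_eq_one_iff p] at hy
    rw [not_not]
    apply (algebraMap (ZMod p) F).injective
    rw [algebraMap_trace_mul m hF hy.2, hu, map_zero]
    refine Finset.sum_eq_zero fun i _ => ?_
    rw [zero_pow (pow_pos (Fact.out : p.Prime).pos i).ne', zero_mul]

include hF hm in
/-- Counting absolute traces along the cosets of `𝔽_qˣ`. -/
lemma card_trace_ne_zero_mul [DecidableEq F] (f : Fˣ → F)
    (hf : ∀ y x : Fˣ, y ^ (p ^ m - 1) = 1 → f (y * x) = y * f x) :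
    (Finset.univ.filter fun x => Algebra.trace (ZMod p) F (f x) ≠ 0).card * (p ^ m - 1) =
      (p ^ m - p ^ (m - 1)) * (Finset.univ.filter fun x => f x + f x ^ p ^ m ≠ 0).card := by
  set Y := Finset.univ.filter fun y : Fˣ => y ^ (p ^ m - 1) = 1 with hY
  -- Multiplication by `y` permutes the units, so each `y` gives the same count; the pairs (`y`,
  -- `x`) are then counted in both orders.
  have h1 : ∀ y ∈ Y, (Finset.univ.filter fun x => Algebra.trace (ZMod p) F (y * f x) ≠ 0).card =
      (Finset.univ.filter fun x => Algebra.trace (ZMod p) F (f x) ≠ 0).card := by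
    intro y hy
    rw [hY, Finset.mem_filter] at hy
    refine Finset.card_bij (fun x _ => y * x) ?_ ?_ ?_
    · intro x hx
      simp only [Finset.mem_filter, Finset.mem_univ, true_and] at hx ⊢
      rwa [hf y x hy.2]
    · intro a _ b _ h
      exact mul_left_cancel h
    · intro x hx
      simp only [Finset.mem_filter, Finset.mem_univ, true_and] at hx ⊢
      refine ⟨y⁻¹ * x, ?_, mul_inv_cancel_left y x⟩
      rwa [← hf y _ hy.2, mul_inv_cancel_left]
  have h2 := Finset.sum_card_bipartiteAbove_eq_sum_card_bipartiteBelow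
    (fun (y x : Fˣ) => Algebra.trace (ZMod p) F (y * f x) ≠ 0) (s := Y) (t := Finset.univ)
  simp only [Finset.bipartiteAbove, Finset.bipartiteBelow] at h2
  rw [Finset.sum_congr rfl h1, Finset.sum_const, hY, card_filter_units_pow_eq_one m hF,
    smul_eq_mul] at h2
  rw [Finset.sum_congr rfl fun x _ => card_filter_units_trace_mul_ne_zero m hm hF (f x),
    ← Finset.sum_filter, Finset.sum_const, smul_eq_mul] at h2
  rw [mul_comm, h2, mul_comm]

end Trace

end QuadraticExtension

/-! ### Niho exponents: from weights to root counts -/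

section Niho

variable {p : ℕ} [Fact p.Prime] {F : Type*} [Field F] [CharP F p] (m : ℕ) [Fintype F]
  (hm : 1 ≤ m) (hF : Fintype.card F = p ^ (2 * m))

include hF in
lemma units_pow_mul_pow_add_one (x : Fˣ) (k : ℕ) :
    (((x ^ ((p ^ m - 1) * k) : Fˣ) : F)) ^ (p ^ m + 1) = 1 := by
  have h : x ^ ((p ^ m - 1) * (p ^ m + 1)) = 1 := by
    rw [← natCard_units_eq m hF]
    exact pow_card_eq_one'
  rw [← Units.val_pow_eq_pow_val, ← pow_mul, mul_right_comm, pow_mul, h, one_pow, Units.val_one]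

include hF in
/-- Up to a nonzero factor, the relative trace of a combination of two Niho monomials is a cubic. -/
lemma add_pow_ne_zero_iff_conjCubic_ne_zero (r : ℕ) (v : F × F) (x : Fˣ) :
    (v.1 * (x : F) ^ ((r + 1) * (p ^ m - 1) + 1) + v.2 * (x : F) ^ ((3 * r + 2) * (p ^ m - 1) + 1)) +
      (v.1 * (x : F) ^ ((r + 1) * (p ^ m - 1) + 1) +
        v.2 * (x : F) ^ ((3 * r + 2) * (p ^ m - 1) + 1)) ^ p ^ m ≠ 0 ↔
    conjCubic p m ((x ^ ((p ^ m - 1) * (2 * r + 1)) : Fˣ) : F) v ≠ 0 := by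
  have hz1 := units_pow_mul_pow_add_one m hF x 1
  rw [mul_one, Units.val_pow_eq_pow_val, pow_succ] at hz1
  have hx0 : (x : F) ≠ 0 := x.ne_zero
  have hxq : (x : F) ^ p ^ m = x * (x : F) ^ (p ^ m - 1) := by
    rw [← pow_succ', Nat.sub_add_cancel (pow_pos (Fact.out : p.Prime).pos m)]
  have hz0 : (x : F) ^ (p ^ m - 1) ≠ 0 := pow_ne_zero _ hx0
  rw [add_pow_char_pow, mul_pow, mul_pow, Units.val_pow_eq_pow_val, pow_mul, conjCubic_apply]
  have he : ∀ s, (x : F) ^ (s * (p ^ m - 1) + 1) = x * ((x : F) ^ (p ^ m - 1)) ^ s := fun s => by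
    rw [pow_succ', mul_comm s, pow_mul]
  have heq : ∀ s, ((x : F) ^ (s * (p ^ m - 1) + 1)) ^ p ^ m =
      x * (x : F) ^ (p ^ m - 1) * (((x : F) ^ (p ^ m - 1)) ^ p ^ m) ^ s := fun s => by
    rw [he, mul_pow, hxq, pow_right_comm]
  rw [heq, heq, he, he]
  generalize (x : F) ^ (p ^ m - 1) = z at *
  generalize z ^ p ^ m = y at *
  have h1 : y ^ (r + 1) * z ^ (r + 1) = 1 := by rw [← mul_pow, hz1, one_pow]
  have h2 : y ^ (3 * r + 2) * z ^ (3 * r + 2) = 1 := by rw [← mul_pow, hz1, one_pow]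
  -- Here y = z⁻¹. The factor z^{3r+1} shifts the exponents 3r+2, r+1, -r, -(3r+1) of z to 3, 2, 1,
  -- 0 times 2r+1.
  have key : (v.1 * (x * z ^ (r + 1)) + v.2 * (x * z ^ (3 * r + 2)) +
      (v.1 ^ p ^ m * (x * z * y ^ (r + 1)) + v.2 ^ p ^ m * (x * z * y ^ (3 * r + 2)))) *
        z ^ (3 * r + 1) =
      x * (v.2 * (z ^ (2 * r + 1)) ^ 3 + v.1 * (z ^ (2 * r + 1)) ^ 2 +
        v.1 ^ p ^ m * z ^ (2 * r + 1) + v.2 ^ p ^ m) := by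
    linear_combination v.1 ^ p ^ m * x * z ^ (2 * r + 1) * h1 + v.2 ^ p ^ m * x * h2
  rw [← mul_ne_zero_iff_right (pow_ne_zero (3 * r + 1) hz0), key, mul_ne_zero_iff_left hx0]

open Classical in
/-- The nonzero `e`-th powers of `F`. -/
noncomputable def nonzeroPowers (F : Type*) [Field F] [Fintype F] (e : ℕ) : Finset Fˣ :=
  Finset.univ.image (powMonoidHom e : Fˣ →* Fˣ)

include hF in
lemma pow_eq_one_of_mem_nonzeroPowers {k : ℕ} {w : Fˣ}
    (hw : w ∈ nonzeroPowers F ((p ^ m - 1) * k)) : (w : F) ^ (p ^ m + 1) = 1 := by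
  classical
  simp only [nonzeroPowers, Finset.mem_image, Finset.mem_univ, true_and] at hw
  obtain ⟨x, rfl⟩ := hw
  exact units_pow_mul_pow_add_one m hF x k

include hm hF in
-- The units form a cyclic group of order (q - 1)(q + 1), so the power map has kernel of order (q -
-- 1) gcd(q + 1, k).
lemma card_nonzeroPowers_mul (k : ℕ) :
    (nonzeroPowers F ((p ^ m - 1) * k)).card * (p ^ m + 1).gcd k = p ^ m + 1 := by
  classical
  have h := card_filter_monoidHom (powMonoidHom ((p ^ m - 1) * k) : Fˣ →* Fˣ) (fun _ => True)
  rw [Finset.filter_true, Finset.filter_true, IsCyclic.card_powMonoidHom_ker,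
    natCard_units_eq m hF, Nat.gcd_mul_left, Finset.card_univ, ← Nat.card_eq_fintype_card,
    natCard_units_eq m hF, mul_assoc] at h
  have hq : 0 < p ^ m - 1 :=
    Nat.sub_pos_of_lt (Nat.one_lt_pow (by omega) (Fact.out : p.Prime).one_lt)
  rw [mul_comm]
  convert (Nat.eq_of_mul_eq_mul_left hq h).symm
  unfold nonzeroPowers
  congr!

open Classical in
/-- The number of roots of the cubic attached to `v` among the nonzero `e`-th powers. -/
noncomputable def rootCount (p m : ℕ) [Fact p.Prime] [CharP F p] (e : ℕ) (v : F × F) : ℕ :=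
  ((nonzeroPowers F e).filter fun w : Fˣ => conjCubic p m (w : F) v = 0).card

lemma rootCount_zero (e : ℕ) :
    rootCount p m e (0 : F × F) = (nonzeroPowers F e).card := by
  simp [rootCount]

lemma rootCount_le_three (e : ℕ) {v : F × F} (hv : v ≠ 0) : rootCount p m e v ≤ 3 := by
  classical
  by_contra! h
  obtain ⟨S, hS, hS4⟩ := Finset.exists_subset_card_eq (n := 4) h
  refine hv (eq_zero_of_conjCubic_eq_zero m
    (S.map ⟨Units.val, Units.val_injective⟩) (by rwa [Finset.card_map]) v fun w hw => ?_)
  rw [Finset.mem_map] at hw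
  obtain ⟨x, hx, rfl⟩ := hw
  exact (Finset.mem_filter.1 (hS hx)).2

include hm hF in
lemma sum_choose_rootCount (k : ℕ) (h4 : 4 ≤ (nonzeroPowers F ((p ^ m - 1) * k)).card)
    (i : ℕ) (hi : i ≤ 4) :
    ∑ v : F × F, (rootCount p m ((p ^ m - 1) * k) v).choose i =
      (nonzeroPowers F ((p ^ m - 1) * k)).card.choose i * (p ^ m) ^ (4 - i) := by
  classical
  refine sum_choose_card_zeros (fun w : Fˣ => conjCubic p m (w : F)) _ (p ^ m) 4
    (pow_pos (Fact.out : p.Prime).pos m) (fun w hw => ?_) ?_ (fun S _ hS v hv => ?_) h4 i hi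
  · exact exists_card_le_conjCubic_mem m hm hF (pow_eq_one_of_mem_nonzeroPowers m hF hw)
  · rw [Fintype.card_prod, hF]
    ring
  · refine eq_zero_of_conjCubic_eq_zero m (S.map ⟨Units.val, Units.val_injective⟩)
      (by rwa [Finset.card_map]) v fun w hw => ?_
    rw [Finset.mem_map] at hw
    obtain ⟨x, hx, rfl⟩ := hw
    exact hv x hx

lemma bijective_pow_primitiveRoot {θ : F} {N : ℕ} (hN : N ≠ 0) (hθ : IsPrimitiveRoot θ N)
    (hcard : Nat.card Fˣ = N) :
    Function.Bijective fun i : Fin N => Units.mk0 θ (hθ.ne_zero hN) ^ (i : ℕ) := by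
  classical
  rw [Fintype.bijective_iff_injective_and_card, Fintype.card_fin, ← Nat.card_eq_fintype_card,
    hcard]
  refine ⟨fun i j hij => Fin.ext (hθ.pow_inj i.2 j.2 ?_), rfl⟩
  have := congrArg Units.val hij
  simpa using this

include hm hF in
/-- The weight of a trace word is determined by the number of roots of the attached cubic. -/
lemma hammingNorm_traceWord [Algebra (ZMod p) F] {θ : F} {N : ℕ} (hθ : IsPrimitiveRoot θ N)
    (hcard : Nat.card Fˣ = N) (r : ℕ) (v : F × F) :
    hammingNorm (traceWord (ZMod p) N (θ ^ ((r + 1) * (p ^ m - 1) + 1))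
      (θ ^ ((3 * r + 2) * (p ^ m - 1) + 1)) v) =
    (p ^ m - p ^ (m - 1)) * ((p ^ m + 1).gcd (2 * r + 1) *
      ((nonzeroPowers F ((p ^ m - 1) * (2 * r + 1))).card -
        rootCount p m ((p ^ m - 1) * (2 * r + 1)) v)) := by
  classical
  have hN : N ≠ 0 := by rw [← hcard]; exact Nat.card_pos.ne'
  have hq : 0 < p ^ m - 1 :=
    Nat.sub_pos_of_lt (Nat.one_lt_pow (by omega) (Fact.out : p.Prime).one_lt)
  let f : Fˣ → F := fun x => v.1 * (x : F) ^ ((r + 1) * (p ^ m - 1) + 1) +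
    v.2 * (x : F) ^ ((3 * r + 2) * (p ^ m - 1) + 1)
  have hf : ∀ y x : Fˣ, y ^ (p ^ m - 1) = 1 → f (y * x) = y * f x := by
    intro y x hy
    have hy' : (y : F) ^ (p ^ m - 1) = 1 := by
      rw [← Units.val_pow_eq_pow_val, hy, Units.val_one]
    have hs : ∀ s, (y : F) ^ (s * (p ^ m - 1) + 1) = y := fun s => by
      rw [pow_succ, mul_comm s, pow_mul, hy', one_pow, one_mul]
    simp only [f, Units.val_mul, mul_pow, hs]
    ring
  have h1 := card_trace_ne_zero_mul m hm hF f hf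
  have h2 : (Finset.univ.filter fun x => f x + f x ^ p ^ m ≠ 0) =
      Finset.univ.filter fun x : Fˣ =>
        conjCubic p m ((powMonoidHom ((p ^ m - 1) * (2 * r + 1)) x : Fˣ) : F) v ≠ 0 :=
    Finset.filter_congr fun x _ => add_pow_ne_zero_iff_conjCubic_ne_zero m hF r v x
  rw [h2, card_filter_monoidHom (powMonoidHom ((p ^ m - 1) * (2 * r + 1)) : Fˣ →* Fˣ)
    (fun w => conjCubic p m (w : F) v ≠ 0), IsCyclic.card_powMonoidHom_ker,
    natCard_units_eq m hF, Nat.gcd_mul_left] at h1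
  have h3 := Finset.card_filter_add_card_filter_not
    (s := nonzeroPowers F ((p ^ m - 1) * (2 * r + 1)))
    (fun w : Fˣ => conjCubic p m (w : F) v = 0)
  have h4 : rootCount p m ((p ^ m - 1) * (2 * r + 1)) v =
    ((nonzeroPowers F ((p ^ m - 1) * (2 * r + 1))).filter
      fun w : Fˣ => conjCubic p m (w : F) v = 0).card := by
    rw [rootCount]
  -- The powers of θ enumerate the units, turning coordinates of the word into elements of `Fˣ`.
  have h5 : hammingNorm (traceWord (ZMod p) N (θ ^ ((r + 1) * (p ^ m - 1) + 1))
      (θ ^ ((3 * r + 2) * (p ^ m - 1) + 1)) v) =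
      (Finset.univ.filter fun x => Algebra.trace (ZMod p) F (f x) ≠ 0).card := by
    have hb := bijective_pow_primitiveRoot hN hθ hcard
    refine Finset.card_bij (fun i _ => Units.mk0 θ (hθ.ne_zero hN) ^ (i : ℕ)) ?_
      (fun a _ b _ h => hb.1 h) ?_
    · intro i hi
      simp only [Finset.mem_filter, Finset.mem_univ, true_and] at hi ⊢
      simpa only [f, traceWord_apply, Units.val_pow_eq_pow_val, Units.val_mk0, pow_right_comm _ (i : ℕ)] using hi
    · intro x hx
      obtain ⟨i, rfl⟩ := hb.2 x
      refine ⟨i, ?_, rfl⟩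
      simp only [Finset.mem_filter, Finset.mem_univ, true_and] at hx ⊢
      simpa only [f, traceWord_apply, Units.val_pow_eq_pow_val, Units.val_mk0, pow_right_comm _ (i : ℕ)] using hx
  rw [h5]
  refine Nat.eq_of_mul_eq_mul_right hq (h1.trans ?_)
  rw [h4, ← h3, Nat.add_sub_cancel_left]
  simp only [nonzeroPowers]
  ring

end Niho

/-! ### Frequencies, positivity and arithmetic of the parameters -/

section Distribution

lemma weightCount_range {K V : Type*} [Field K] [DecidableEq K] [AddCommGroup V] [Module K V]
    [Fintype V] {N : ℕ} (L : V →ₗ[K] (Fin N → K)) (hL : Function.Injective L) (w : ℕ) :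
    weightCount (LinearMap.range L) w =
      (Finset.univ.filter fun v => hammingNorm (L v) = w).card := by
  have h : {c : Fin N → K | c ∈ LinearMap.range L ∧ hammingNorm c = w} =
      L '' (Finset.univ.filter fun v => hammingNorm (L v) = w : Finset V) := by
    ext c
    simp only [Set.mem_ofPred_eq, LinearMap.mem_range, Set.mem_image, Finset.coe_filter,
      Finset.mem_univ, true_and]
    constructor
    · rintro ⟨⟨v, rfl⟩, h⟩
      exact ⟨v, h, rfl⟩
    · rintro ⟨v, h, rfl⟩
      exact ⟨⟨v, rfl⟩, h⟩
  rw [weightCount, h, Set.ncard_image_of_injective _ hL, Set.ncard_coe_finset]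

lemma hasMinDist_of_forall_le {K : Type*} [Field K] [DecidableEq K] {N : ℕ}
    (C : Submodule K (Fin N → K)) (d : ℕ) (hex : ∃ c ∈ C, c ≠ 0 ∧ hammingNorm c = d)
    (hle : ∀ c ∈ C, c ≠ 0 → d ≤ hammingNorm c) : HasMinDist C d := by
  refine ⟨?_, ?_⟩
  · obtain ⟨c, hc, h0, hd⟩ := hex
    exact ⟨c, hc, 0, C.zero_mem, h0, by rw [hammingDist_zero_right, hd]⟩
  · rintro e ⟨x, hx, y, hy, hxy, rfl⟩
    rw [hammingDist_eq_hammingNorm]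
    exact hle _ (C.add_mem (C.neg_mem hx) hy) fun h => hxy (neg_add_eq_zero.1 h)

/-- All four solutions of the moment equations are positive. -/
lemma pos_of_moment_equations {q M n₀ n₁ n₂ n₃ : ℚ} (hM : 4 ≤ M) (hMq : M ≤ q + 1)
    (h3 : n₃ = M * (M - 1) * (M - 2) / 6 * (q - 1))
    (h2 : n₂ + 3 * n₃ = M * (M - 1) / 2 * (q ^ 2 - 1))
    (h1 : n₁ + 2 * n₂ + 3 * n₃ = M * (q ^ 3 - 1))
    (h0 : n₀ + n₁ + n₂ + n₃ = q ^ 4 - 1) : 0 < n₀ ∧ 0 < n₁ ∧ 0 < n₂ ∧ 0 < n₃ := by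
  -- In terms of the slack v ≥ 0, the frequencies n₀, n₁ and n₂ become expressions whose positivity
  -- is visible term by term.
  obtain ⟨v, hv⟩ : ∃ v, v = q + 1 - M := ⟨_, rfl⟩
  have hv0 : 0 ≤ v := by linarith
  have hq : 0 < q - 1 := by linarith
  have hqq : 0 ≤ q * (q - 1) := by nlinarith
  have hM0 : 0 < M := by linarith
  have hM1 : 0 < M - 1 := by linarith
  have hM2 : 0 < M - 2 := by linarith
  have hMv : M = q + 1 - v := by linarith
  have e2 : n₂ = M * (M - 1) / 2 * (q - 1) * (v + 2) := by
    rw [hv]; linear_combination h2 - 3 * h3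
  have e1 : n₁ = M * (q - 1) * (q * (q - 1) / 2 + 1 + 3 * v / 2 + v ^ 2 / 2) := by
    rw [hv]; linear_combination h1 - 3 * h3 - 2 * (h2 - 3 * h3)
  have e0 : n₀ = (q - 1) * (q * (q - 1) * (q + 1) / 3 + v * (q * (q - 1) / 2 + 1 / 3) + v ^ 2 / 2 +
      v ^ 3 / 6) := by
    rw [hv]; linear_combination h0 - h1 + h2 - h3
  have hq1 : 0 < q + 1 := by linarith
  have hq0 : 0 < q := by linarith
  refine ⟨?_, ?_, ?_, ?_⟩
  · rw [e0]; positivity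
  · rw [e1]; positivity
  · rw [e2]; positivity
  · rw [h3]; positivity

lemma gcd_two_mul_of_odd {k Q : ℕ} (hk : Odd k) (hQ : Even Q) :
    Nat.gcd (2 * k) Q = 2 * Nat.gcd Q k := by
  obtain ⟨h, rfl⟩ := hQ
  rw [← two_mul, Nat.gcd_mul_left, Nat.gcd_comm (2 * h),
    Nat.Coprime.gcd_mul_left_cancel_right h hk.coprime_two_left]

/-- Since `Q` is even and the gcd odd, `M` is even; M = 2 would make Q = 2 gcd(Q, k) divide 2k. -/
lemma four_le_of_mul_gcd_eq {k Q M : ℕ} (hQ0 : 0 < Q) (hk : Odd k) (hQ : Even Q)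
    (hM : M * Nat.gcd Q k = Q) (hdvd : ¬ Q ∣ 2 * k) : 4 ≤ M := by
  have hg : Odd (Nat.gcd Q k) := hk.of_dvd_nat (Nat.gcd_dvd_right _ _)
  have hMe : Even M := by
    rw [← hM, Nat.even_mul] at hQ
    exact hQ.resolve_right (Nat.not_even_iff_odd.2 hg)
  obtain ⟨c, rfl⟩ := hMe
  by_contra! h
  have : c = 0 ∨ c = 1 := by omega
  obtain rfl | rfl := this
  · omega
  · refine hdvd ?_
    rw [← hM]
    exact mul_dvd_mul_left 2 (Nat.gcd_dvd_right _ _)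

end Distribution

/-! ### The weight distribution -/

theorem theorem6 (p : ℕ) [Fact p.Prime] (hp : Odd p)
    (m n : ℕ) (hm : 1 ≤ m) (hn : n = 2 * m)
    {F : Type*} [Field F] [Fintype F] [Algebra (ZMod p) F] (hF : Fintype.card F = p ^ n)
    (θ : F) (hθ : IsPrimitiveRoot θ (p ^ n - 1))
    (t : ℕ) (ht : t ≡ 2 [MOD 4]) (ht' : ¬ t ≡ 0 [MOD p ^ m + 1])
    (s₁ s₂ : ℕ) (hs₁ : 4 * s₁ = t + 2) (hs₂ : 4 * s₂ = 3 * t + 2)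
    (d₁ d₂ : ℕ) (hd₁ : d₁ = s₁ * (p ^ m - 1) + 1) (hd₂ : d₂ = s₂ * (p ^ m - 1) + 1)
    (l : ℕ) (hl : l = Nat.gcd t (p ^ m + 1))
    (C : Submodule (ZMod p) (Fin (p ^ n - 1) → ZMod p))
    (hC : C = dualCode (twoZeroCode p (p ^ n - 1) θ d₁ d₂)) :
    Module.finrank (ZMod p) C = 4 * m ∧
    Set.ncard {w : ℕ | ∃ c ∈ C, c ≠ 0 ∧ hammingNorm c = w} = 4 ∧
    ∃ w₁ w₂ w₃ w₄ : ℕ,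
      (w₁ : ℚ) = ((p : ℚ) ^ m - (p : ℚ) ^ (m - 1)) * ((p : ℚ) ^ m + 1 - 3 * (l : ℚ) / 2) ∧
      (w₂ : ℚ) = ((p : ℚ) ^ m - (p : ℚ) ^ (m - 1)) * ((p : ℚ) ^ m + 1 - (l : ℚ)) ∧
      (w₃ : ℚ) = ((p : ℚ) ^ m - (p : ℚ) ^ (m - 1)) * ((p : ℚ) ^ m + 1 - (l : ℚ) / 2) ∧
      (w₄ : ℚ) = ((p : ℚ) ^ m - (p : ℚ) ^ (m - 1)) * ((p : ℚ) ^ m + 1) ∧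
      HasMinDist C w₁ ∧
      weightCount C 0 = 1 ∧
      (weightCount C w₁ : ℚ) =
        2 * ((p : ℚ) ^ (2 * m) - 1) * ((l : ℚ) - (p : ℚ) ^ m - 1)
          * ((l : ℚ) - 2 * (p : ℚ) ^ m - 2) / (3 * (l : ℚ) ^ 3) ∧
      (weightCount C w₂ : ℚ) =
        ((p : ℚ) ^ (2 * m) - 1) * (2 * (p : ℚ) ^ m + 2 - ((p : ℚ) ^ m + 3) * (l : ℚ))
          * ((l : ℚ) - 2 * (p : ℚ) ^ m - 2) / (l : ℚ) ^ 3 ∧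
      (weightCount C w₃ : ℚ) =
        2 * ((p : ℚ) ^ (2 * m) - 1)
          * (((p : ℚ) ^ (2 * m) + 2 * (p : ℚ) ^ m + 3) * (l : ℚ) ^ 2
            - (2 * (p : ℚ) ^ (2 * m) + 7 * (p : ℚ) ^ m + 5) * (l : ℚ)
            + 2 * ((p : ℚ) ^ m + 1) ^ 2) / (l : ℚ) ^ 3 ∧
      (weightCount C w₄ : ℚ) =
        ((p : ℚ) ^ (2 * m) - 1)
          * (3 * ((p : ℚ) ^ (2 * m) + 1) * (l : ℚ) ^ 3
            - (6 * (p : ℚ) ^ (2 * m) + 9 * (p : ℚ) ^ m + 11) * (l : ℚ) ^ 2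
            + 6 * ((p : ℚ) ^ (2 * m) + 3 * (p : ℚ) ^ m + 2) * (l : ℚ)
            - 4 * ((p : ℚ) ^ m + 1) ^ 2) / (3 * (l : ℚ) ^ 3) ∧
      ∀ w : ℕ, w ≠ 0 → w ≠ w₁ → w ≠ w₂ → w ≠ w₃ → w ≠ w₄ → weightCount C w = 0 := by
  classical
  have hpp := (Fact.out : p.Prime)
  have : CharP F p := charP_of_injective_algebraMap (algebraMap (ZMod p) F).injective p
  subst hn
  obtain ⟨r, rfl⟩ : ∃ r, t = 2 * (2 * r + 1) := by
    have h : t % 4 = 2 := ht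
    exact ⟨t / 4, by omega⟩
  obtain rfl : s₁ = r + 1 := by omega
  obtain rfl : s₂ = 3 * r + 2 := by omega
  have hkodd : Odd (2 * r + 1) := odd_two_mul_add_one r
  have hQeven : Even (p ^ m + 1) := (hp.pow).add_one
  have hMg := card_nonzeroPowers_mul m hm hF (2 * r + 1)
  have hM4 := four_le_of_mul_gcd_eq (Nat.succ_pos _) hkodd hQeven hMg
    (fun h => ht' ((Nat.modEq_zero_iff_dvd).2 h))
  rw [gcd_two_mul_of_odd hkodd hQeven] at hl
  have hcard : Nat.card Fˣ = p ^ (2 * m) - 1 := by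
    rw [Nat.card_eq_fintype_card, Fintype.card_units, hF]
  have hwt := hammingNorm_traceWord m hm hF hθ hcard r
  have hsum := sum_choose_rootCount m hm hF (2 * r + 1) hM4
  have hj3 : ∀ v : F × F, v ≠ 0 → rootCount p m ((p ^ m - 1) * (2 * r + 1)) v ≤ 3 :=
    fun v hv => rootCount_le_three m _ hv
  have hj0 := rootCount_zero (p := p) (F := F) m ((p ^ m - 1) * (2 * r + 1))
  rw [← hd₁, ← hd₂] at hwt
  generalize rootCount (F := F) p m ((p ^ m - 1) * (2 * r + 1)) = j at *
  generalize (nonzeroPowers F ((p ^ m - 1) * (2 * r + 1))).card = M at *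
  generalize (p ^ m + 1).gcd (2 * r + 1) = g at *
  have hg : 0 < g := Nat.pos_of_ne_zero (by rintro rfl; omega)
  have hu : 0 < p ^ m - p ^ (m - 1) :=
    Nat.sub_pos_of_lt (Nat.pow_lt_pow_right hpp.one_lt (by omega))
  have hucast : ((p ^ m - p ^ (m - 1) : ℕ) : ℚ) = (p : ℚ) ^ m - (p : ℚ) ^ (m - 1) := by
    rw [Nat.cast_sub (Nat.pow_le_pow_right hpp.pos (by omega)), Nat.cast_pow, Nat.cast_pow]
  generalize p ^ m - p ^ (m - 1) = u at *
  -- A nonzero pair has at most 3 roots among M ≥ 4 points, hence positive weight.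
  have hinj : Function.Injective (traceWord (ZMod p) (p ^ (2 * m) - 1) (θ ^ d₁) (θ ^ d₂)) := by
    rw [← LinearMap.ker_eq_bot, LinearMap.ker_eq_bot']
    intro v hv
    by_contra hv0
    have h := hwt v
    rw [hv, hammingNorm_zero] at h
    have h3 := hj3 v hv0
    exact (Nat.mul_pos hu (Nat.mul_pos hg (by omega))).ne h
  have hone : ∀ d, (θ ^ d) ^ (p ^ (2 * m) - 1) = 1 := fun d => by
    rw [pow_right_comm, hθ.pow_eq_one, one_pow]
  rw [twoZeroCode, dualCode_cyclicCode_minpoly_mul (hone d₁) (hone d₂) hinj] at hC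
  generalize traceWord (ZMod p) (p ^ (2 * m) - 1) (θ ^ d₁) (θ ^ d₂) = L at hC hwt hinj
  have hjle : ∀ v, j v ≤ M := fun v => by
    by_cases hv : v = 0
    · rw [hv, hj0]
    · exact (hj3 v hv).trans (by omega)
  have hweq : ∀ v, ∀ i ≤ M, hammingNorm (L v) = u * (g * (M - i)) ↔ j v = i := by
    intro v i hi
    rw [hwt, Nat.mul_right_inj hu.ne', Nat.mul_right_inj hg.ne']
    have := hjle v
    omega
  have hcount : ∀ i ≤ 3, weightCount C (u * (g * (M - i))) =
      (Finset.univ.filter fun v : F × F => v ≠ 0 ∧ j v = i).card := by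
    intro i hi
    rw [hC, weightCount_range L hinj]
    congr 1
    refine Finset.filter_congr fun v _ => ?_
    rw [hweq v i (by omega)]
    -- The zero pair drops out because `j 0 = M` exceeds `i ≤ 3`.
    refine ⟨fun h => ⟨?_, h⟩, fun h => h.2⟩
    rintro rfl
    omega
  obtain ⟨e3, e2, e1, e0⟩ := card_filter_eq_of_sum_choose j M (p ^ m) hj0 hj3 hsum
  beta_reduce at e0 e1 e2 e3
  rw [← hcount 0 (by norm_num), ← hcount 1 (by norm_num), ← hcount 2 (by norm_num),
    ← hcount 3 (by norm_num)] at e0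
  rw [← hcount 1 (by norm_num), ← hcount 2 (by norm_num), ← hcount 3 (by norm_num)] at e1
  rw [← hcount 2 (by norm_num), ← hcount 3 (by norm_num)] at e2
  rw [← hcount 3 (by norm_num)] at e3
  have hMgQ : (M : ℚ) * g = (p : ℚ) ^ m + 1 := by exact_mod_cast hMg
  rw [Nat.cast_pow] at e0 e1 e2 e3
  have hM4Q : (4 : ℚ) ≤ M := by exact_mod_cast hM4
  have hgQ : (0 : ℚ) < g := by exact_mod_cast hg
  have hMle : (M : ℚ) ≤ (p : ℚ) ^ m + 1 := by
    rw [← hMgQ]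
    exact_mod_cast Nat.le_mul_of_pos_right M hg
  obtain ⟨p0, p1, p2, p3⟩ := pos_of_moment_equations hM4Q hMle e3 e2 e1 e0
  have hwC : ∀ c ∈ C, c ≠ 0 → ∃ i ≤ 3, hammingNorm c = u * (g * (M - i)) := by
    intro c hc hc0
    rw [hC] at hc
    obtain ⟨v, rfl⟩ := hc
    exact ⟨j v, hj3 v (by rintro rfl; exact hc0 (map_zero L)), hwt v⟩
  have hex : ∀ i ≤ 3, ∃ c ∈ C, c ≠ 0 ∧ hammingNorm c = u * (g * (M - i)) := by
    intro i hi
    have hpos : 0 < weightCount C (u * (g * (M - i))) := by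
      have : (0 : ℚ) < weightCount C (u * (g * (M - i))) := by interval_cases i <;> assumption
      exact_mod_cast this
    rw [hcount i hi, Finset.card_pos] at hpos
    obtain ⟨v, hv⟩ := hpos
    simp only [Finset.mem_filter, Finset.mem_univ, true_and] at hv
    refine ⟨L v, hC ▸ ⟨v, rfl⟩, fun h => hv.1 (hinj (h.trans (map_zero L).symm)), ?_⟩
    exact (hweq v i (by omega)).2 hv.2
  have hset : {w : ℕ | ∃ c ∈ C, c ≠ 0 ∧ hammingNorm c = w} =
      ((Finset.range 4).image fun i => u * (g * (M - i)) : Finset ℕ) := by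
    ext w
    simp only [Set.mem_ofPred_eq, Finset.coe_image, Finset.coe_range, Set.mem_image, Set.mem_Iio]
    constructor
    · rintro ⟨c, hc, hc0, rfl⟩
      obtain ⟨i, hi, h⟩ := hwC c hc hc0
      exact ⟨i, by omega, h.symm⟩
    · rintro ⟨i, hi, rfl⟩
      exact hex i (by omega)
  have hp2 : (p : ℚ) ^ (2 * m) = ((p : ℚ) ^ m) ^ 2 := by rw [← pow_mul, mul_comm]
  have hlQ : (l : ℚ) = 2 * g := by rw [hl]; push_cast; ring
  have hP : (p : ℚ) ^ m = M * g - 1 := by linarith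
  have hcastw : ∀ i ≤ 3, ((u * (g * (M - i)) : ℕ) : ℚ) =
      ((p : ℚ) ^ m - (p : ℚ) ^ (m - 1)) * ((p : ℚ) ^ m + 1 - i * g) := by
    intro i hi
    rw [Nat.cast_mul, Nat.cast_mul, Nat.cast_sub (by omega), hucast, ← hMgQ]
    ring
  refine ⟨?_, ?_, u * (g * (M - 3)), u * (g * (M - 2)), u * (g * (M - 1)), u * (g * (M - 0)),
    ?_, ?_, ?_, ?_, ?_, ?_, ?_, ?_, ?_, ?_, ?_⟩
  · rw [hC, LinearMap.finrank_range_of_inj hinj, Module.finrank_prod]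
    have h := Module.card_eq_pow_finrank (K := ZMod p) (V := F)
    rw [hF, ZMod.card] at h
    have := Nat.pow_right_injective hpp.two_le h
    omega
  · rw [hset, Set.ncard_coe_finset, Finset.card_image_of_injOn, Finset.card_range]
    intro a ha b hb hab
    simp only [Finset.coe_range, Set.mem_Iio] at ha hb
    have h : u * (g * (M - a)) = u * (g * (M - b)) := hab
    rw [Nat.mul_right_inj hu.ne', Nat.mul_right_inj hg.ne'] at h
    omega
  · rw [hcastw 3 le_rfl, hlQ]; push_cast; ring
  · rw [hcastw 2 (by norm_num), hlQ]; push_cast; ring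
  · rw [hcastw 1 (by norm_num), hlQ]; push_cast; ring
  · rw [hcastw 0 (by norm_num)]; push_cast; ring
  · refine hasMinDist_of_forall_le C _ (hex 3 le_rfl) fun c hc hc0 => ?_
    obtain ⟨i, hi, h⟩ := hwC c hc hc0
    rw [h]
    exact Nat.mul_le_mul_left _ (Nat.mul_le_mul_left _ (by omega))
  · rw [hC, weightCount_range L hinj, Finset.card_eq_one]
    refine ⟨0, ?_⟩
    ext v
    simp only [Finset.mem_filter, Finset.mem_univ, true_and, Finset.mem_singleton,
      hammingNorm_eq_zero]
    exact map_eq_zero_iff L hinj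
  · rw [e3, hp2, hlQ, hP]
    field_simp
    ring
  · rw [eq_sub_of_add_eq e2, e3, hp2, hlQ, hP]
    field_simp
    ring
  · have h2 := eq_sub_of_add_eq e2
    rw [e3] at h2
    rw [eq_sub_of_add_eq (eq_sub_of_add_eq e1), h2, e3, hp2, hlQ, hP]
    field_simp
    ring
  -- Inclusion–exclusion: the alternating sum of the binomial moments isolates the pairs without
  -- roots.
  · have h : (weightCount C (u * (g * (M - 0))) : ℚ) = ((p : ℚ) ^ m) ^ 4 - 1 -
        M * (((p : ℚ) ^ m) ^ 3 - 1) + M * (M - 1) / 2 * (((p : ℚ) ^ m) ^ 2 - 1) -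
        M * (M - 1) * (M - 2) / 6 * ((p : ℚ) ^ m - 1) := by
      linear_combination e0 - e1 + e2 - e3
    rw [h, hp2, hlQ, hP]
    field_simp
    ring
  · intro w hw0 hw1 hw2 hw3 hw4
    rw [hC, weightCount_range L hinj, Finset.card_eq_zero, Finset.filter_eq_empty_iff]
    rintro v - rfl
    by_cases hv : v = 0
    · exact hw0 (by rw [hv, map_zero, hammingNorm_zero])
    · have h3 := hj3 v hv
      have h := hwt v
      interval_cases j v <;> contradiction
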